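/- Let $R$ be a unital associative ring; modules are right $R$-modules. Let $\zeta\colon Q_0\to Q_1$ be a homomorphism between injective $R$-modules with kernel $T$, and set $\mathcal B_\zeta=\{X\mid \mathrm{Hom}_R(X,\zeta)\colon \mathrm{Hom}_R(X,Q_0)\to \mathrm{Hom}_R(X,Q_1)\text{ is surjective}\}$ and ${}^{\circ}T=\{X\mid \mathrm{Hom}_R(X,T)=0\}$. Assume that $T$ is cosilting with respect to $\zeta$, i.e. that $\mathcal B_\zeta$ is exactly the class of all modules that embed into a direct product of copies of $T$. Let $\zeta^\bullet$ be $\zeta$ regarded as a complex concentrated in degrees $0$ and $1$, and put, inside the bounded derived category $D^b(R)$ of $\mathrm{Mod}(R)$, $${}^{\perp_{\le 0}}\zeta^\bullet=\{X\mid \mathrm{Hom}_{D(R)}(X,\zeta^\bullet[i])=0\text{ for all }i\le 0\},\qquad {}^{\perp_{>1}}\zeta^\bullet=\{X\mid \mathrm{Hom}_{D(R)}(X,\zeta^\bullet[i])=0\text{ for all }i>1\}.$$ Then $({}^{\circ}T,\mathcal B_\zeta)$ is a torsion pair in $\mathrm{Mod}(R)$, the pair $({}^{\perp_{\le 0}}\zeta^\bullet,{}^{\perp_{>1}}\zeta^\bullet)$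 is a t-structure on $D^b(R)$, and it coincides with the Happel–Reiten–Smalø t-structure of this torsion pair, i.e. $${}^{\perp_{\le 0}}\zeta^\bullet=\{X\in D^b(R)\mid H^i(X)=0\text{ for all }i>0,\ H^0(X)\in{}^{\circ}T\},$$ $${}^{\perp_{>1}}\zeta^\bullet=\{X\in D^b(R)\mid H^i(X)=0\text{ for all }i<-1,\ H^{-1}(X)\in\mathcal B_\zeta\}.$$ -/

import Mathlib

open CategoryTheory

universe w v u

namespace Cosilting

section Modules

/-- The category of right `R`-modules, i.e. of left modules over the opposite ring. -/
abbrev ModR (R : Type u) [Ring R] := ModuleCat.{u} Rᵐᵒᵖ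

variable {R : Type u} [Ring R]

/-- The class `°Y` of all modules `X` with `Hom(X, Y) = 0`. -/
def leftHomOrthogonal (Y : ModR R) : ObjectProperty (ModR R) :=
  fun X => ∀ f : X ⟶ Y, f = 0

/-- The class `Cogen(T)` of all modules that embed into a direct product of copies of `T`. -/
def Cogen (T : ModR R) : ObjectProperty (ModR R) :=
  fun X => ∃ (I : Type u) (j : X ⟶ ModuleCat.of Rᵐᵒᵖ (I → T)), Function.Injective j

/-- The class `B_ζ` of all modules `X` such that `Hom(X, ζ) : Hom(X, Q₀) → Hom(X, Q₁)`
is an epimorphism (i.e. surjective). -/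
def classB {Q₀ Q₁ : ModR R} (ζ : Q₀ ⟶ Q₁) : ObjectProperty (ModR R) :=
  fun X => Function.Surjective (fun h : X ⟶ Q₀ => h ≫ ζ)

/-- `T` is cosilting with respect to `ζ : Q₀ ⟶ Q₁`: the modules `Q₀` and `Q₁` are injective,
there is an exact sequence `0 ⟶ T ⟶ Q₀ ⟶ Q₁` with second map `ζ` (so `T` is the kernel of `ζ`),
and `Cogen(T) = B_ζ`. -/
structure IsCosilting (T : ModR R) {Q₀ Q₁ : ModR R} (ζ : Q₀ ⟶ Q₁) : Prop where
  injective₀ : Injective Q₀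
  injective₁ : Injective Q₁
  exists_copresentation : ∃ f : T ⟶ Q₀, Function.Injective f ∧ Function.Exact f ζ
  cogen_eq : Cogen T = classB ζ

end Modules

section TorsionPair

variable {A : Type u} [Category.{v} A] [Abelian A]

/-- A torsion pair in an abelian category: two full subcategories (closed under isomorphisms)
without nonzero morphisms from the first to the second, such that every object is an extension
of an object of the second by an object of the first. -/
structure IsTorsionPair (𝒯 ℱ : ObjectProperty A) : Prop where
  torsion_iso : 𝒯.IsClosedUnderIsomorphisms
  torsionFree_iso : ℱ.IsClosedUnderIsomorphisms
  hom_eq_zero : ∀ ⦃X Y : A⦄, 𝒯 X → ℱ Y → ∀ f : X ⟶ Y, f = 0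
  exists_shortExact : ∀ X : A, ∃ S : ShortComplex A,
    S.ShortExact ∧ S.X₂ = X ∧ 𝒯 S.X₁ ∧ ℱ S.X₃

variable [HasDerivedCategory.{w} A]

variable (A) in
/-- The bounded derived category: the full triangulated subcategory of the derived category
on the objects with bounded cohomology. -/
abbrev BoundedDerivedCategory :=
  (DerivedCategory.TStructure.t (C := A)).bounded.FullSubcategory

/-- The Happel-Reiten-Smalø class of all `X` in the bounded derived category with
`Hⁱ(X) = 0` for `i > 0` and `H⁰(X) ∈ 𝒯`. -/
def hrsLE (𝒯 : ObjectProperty A) : ObjectProperty (BoundedDerivedCategory A) :=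
  fun X =>
    (∀ i : ℤ, 0 < i → Limits.IsZero ((DerivedCategory.homologyFunctor A i).obj X.obj)) ∧
      𝒯 ((DerivedCategory.homologyFunctor A 0).obj X.obj)

/-- The Happel-Reiten-Smalø class of all `X` in the bounded derived category with
`Hⁱ(X) = 0` for `i < -1` and `H⁻¹(X) ∈ ℱ`. -/
def hrsGE (ℱ : ObjectProperty A) : ObjectProperty (BoundedDerivedCategory A) :=
  fun X =>
    (∀ i : ℤ, i < -1 → Limits.IsZero ((DerivedCategory.homologyFunctor A i).obj X.obj)) ∧
      ℱ ((DerivedCategory.homologyFunctor A (-1)).obj X.obj)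

/-- The class of all `X` in the derived category with `Hom(X, Y[i]) = 0` for all `i ≤ n`. -/
def perpLE (n : ℤ) (Y : DerivedCategory A) : ObjectProperty (DerivedCategory A) :=
  fun X => ∀ i : ℤ, i ≤ n → ∀ f : X ⟶ Y⟦i⟧, f = 0

/-- The class of all `X` in the derived category with `Hom(X, Y[i]) = 0` for all `i > n`. -/
def perpGT (n : ℤ) (Y : DerivedCategory A) : ObjectProperty (DerivedCategory A) :=
  fun X => ∀ i : ℤ, n < i → ∀ f : X ⟶ Y⟦i⟧, f = 0

/-- The restriction of a class of objects of the derived category to the bounded derived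
category. -/
def restrictBounded (P : ObjectProperty (DerivedCategory A)) :
    ObjectProperty (BoundedDerivedCategory A) :=
  fun X => P X.obj

/-- The morphism `ζ` seen as a complex concentrated in degrees `0` and `1`, as an object of the
derived category. -/
noncomputable def twoTerm {Q₀ Q₁ : A} (ζ : Q₀ ⟶ Q₁) : DerivedCategory A :=
  DerivedCategory.Q.obj
    (HomologicalComplex.double ζ (c := ComplexShape.up ℤ) (i₀ := 0) (i₁ := 1) (zero_add 1))

end TorsionPair

end Cosilting

/-! `ζ` in degrees 0 and 1 is a bounded below complex of injectives, so morphisms into it in the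
derived category are chain maps up to homotopy. Injectivity reduces their vanishing to cohomology
(`forall_homotopy_zero_iff`): after a shift, `Hom(X, ζ[i]) = 0` iff `H⁻ⁱ(X)` lies in `°T` and
`H¹⁻ⁱ(X)` in `B_ζ`. Over a range of `i` the two conditions overlap in all but one degree, and `°T ∩
B_ζ = 0` because `B_ζ = Cogen(T)`. Overlapping degrees therefore vanish, while the boundary degree
keeps one condition: the perpendicular classes are the tilted ones. The torsion pair comes from the
reject of `T` (`IsCosilting.leftHomOrthogonal_reject`). The tilted t-structure is glued from
truncations and the torsion sequence of `H⁰` (`extensionProduct_tilt`), then restricted to bounded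
objects. -/

namespace Cosilting

/-! ### Null-homotopic maps into a two-term complex of injectives -/

section HomToTwoTerm

open Limits HomologicalComplex

variable {A : Type u} [Category.{v} A] [Abelian A]

section Extension

variable (K : CochainComplex A ℤ)

/-- The differential embeds `Kⁱ` modulo cycles into `Kʲ`, and maps into `J` extend along
monomorphisms. -/
lemma exists_d_comp_eq_of_injective {J : A} [Injective J] {i j : ℤ} (hij : i + 1 = j)
    (φ : K.X i ⟶ J) (hφ : K.iCycles i ≫ φ = 0) : ∃ h : K.X j ⟶ J, K.d i j ≫ h = φ := by
  let S := ShortComplex.mk (K.iCycles i) (K.d i j) (by simp)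
  have hS : S.Exact := S.exact_of_f_is_kernel (K.cyclesIsKernel i j (by simp [hij]))
  exact ⟨hS.descToInjective φ hφ, hS.comp_descToInjective φ hφ⟩

lemma exists_extend_homology_of_injective {J : A} [Injective J] {i j : ℤ}
    (g : K.homology j ⟶ J) :
    ∃ φ : K.X j ⟶ J, K.iCycles j ≫ φ = K.homologyπ j ≫ g ∧ K.d i j ≫ φ = 0 := by
  refine ⟨Injective.factorThru (K.homologyπ j ≫ g) (K.iCycles j), by simp, ?_⟩
  rw [← K.toCycles_i i j, Category.assoc, Injective.comp_factorThru, ← Category.assoc,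
    K.toCycles_comp_homologyπ, zero_comp]

lemma exists_homology_desc {J : A} {i j : ℤ} (hij : i + 1 = j) (φ : K.cycles j ⟶ J)
    (hφ : K.toCycles i j ≫ φ = 0) : ∃ g : K.homology j ⟶ J, K.homologyπ j ≫ g = φ := by
  have h := K.homologyIsCokernel i j (by simp [← hij])
  exact ⟨h.desc (CokernelCofork.ofπ φ hφ), h.fac _ WalkingParallelPair.one⟩

end Extension

variable {Q₀ Q₁ : A} (ζ : Q₀ ⟶ Q₁)

/-- The cochain complex concentrated in degrees `0` and `1` attached to a morphism. -/
noncomputable abbrev twoTermComplex : CochainComplex A ℤ :=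
  double ζ (c := ComplexShape.up ℤ) (i₀ := 0) (i₁ := 1) (zero_add 1)

/-- The degree zero term of the two-term complex. -/
noncomputable abbrev twoTermX₀ : (twoTermComplex ζ).X 0 ≅ Q₀ :=
  doubleXIso₀ ζ (c := ComplexShape.up ℤ) (i₀ := 0) (i₁ := 1) (zero_add 1)

/-- The degree one term of the two-term complex. -/
noncomputable abbrev twoTermX₁ : (twoTermComplex ζ).X 1 ≅ Q₁ :=
  doubleXIso₁ ζ (c := ComplexShape.up ℤ) (i₀ := 0) (i₁ := 1) (zero_add 1) zero_ne_one

lemma twoTermComplex_d :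
    (twoTermComplex ζ).d 0 1 = (twoTermX₀ ζ).hom ≫ ζ ≫ (twoTermX₁ ζ).inv :=
  double_d _ _ _

lemma twoTermComplex_d_neg : (twoTermComplex ζ).d (-1) 0 = 0 :=
  double_d_eq_zero₀ ζ (c := ComplexShape.up ℤ) (zero_add 1) _ _ (by simp)

lemma twoTermComplex_isKInjective [Injective Q₀] [Injective Q₁] :
    (twoTermComplex ζ).IsKInjective := by
  have : (twoTermComplex ζ).IsStrictlyGE 0 := by
    rw [CochainComplex.isStrictlyGE_iff]
    exact fun i hi => isZero_double_X _ _ _ (by lia) (by lia)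
  have (n : ℤ) : Injective ((twoTermComplex ζ).X n) := by
    by_cases h₀ : n = 0
    · subst h₀
      exact Injective.of_iso (twoTermX₀ ζ).symm inferInstance
    by_cases h₁ : n = 1
    · subst h₁
      exact Injective.of_iso (twoTermX₁ ζ).symm inferInstance
    exact Injective.of_iso ((isZero_double_X ζ (c := ComplexShape.up ℤ) (zero_add 1) n h₀ h₁).iso
      (isZero_zero A)).symm inferInstance
  exact CochainComplex.isKInjective_of_injective _ 0

variable {ζ} {K : CochainComplex A ℤ}

lemma exists_hom_twoTermComplex (φ₀ : K.X 0 ⟶ Q₀) (φ₁ : K.X 1 ⟶ Q₁)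
    (h₀ : K.d (-1) 0 ≫ φ₀ = 0) (h₁ : φ₀ ≫ ζ = K.d 0 1 ≫ φ₁) :
    ∃ f : K ⟶ twoTermComplex ζ,
      f.f 0 ≫ (twoTermX₀ ζ).hom = φ₀ ∧ f.f 1 ≫ (twoTermX₁ ζ).hom = φ₁ := by
  classical
  -- The degree is a variable, so the two nonzero components are transported by `eqToHom`.
  let F : ∀ n, K.X n ⟶ (twoTermComplex ζ).X n := fun n =>
    if h : n = 0 then
      eqToHom (by rw [h]) ≫ φ₀ ≫ (twoTermX₀ ζ).inv ≫ eqToHom (by rw [h])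
    else if h : n = 1 then
      eqToHom (by rw [h]) ≫ φ₁ ≫ (twoTermX₁ ζ).inv ≫ eqToHom (by rw [h])
    else 0
  have hF₀ : F 0 = φ₀ ≫ (twoTermX₀ ζ).inv := by simp [F]
  have hF₁ : F 1 = φ₁ ≫ (twoTermX₁ ζ).inv := by simp [F]
  refine ⟨{ f := F, comm' := ?_ }, by simp [hF₀], by simp [hF₁]⟩
  rintro i j rfl
  by_cases hi₀ : i = 0
  · subst hi₀
    change F 0 ≫ (twoTermComplex ζ).d 0 1 = K.d 0 1 ≫ F 1
    rw [hF₀, hF₁, twoTermComplex_d, ← reassoc_of% h₁]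
    simp
  by_cases hi₁ : i = -1
  · subst hi₁
    change F (-1) ≫ (twoTermComplex ζ).d (-1) 0 = K.d (-1) 0 ≫ F 0
    rw [hF₀, reassoc_of% h₀, zero_comp, twoTermComplex_d_neg, comp_zero]
  · apply (isZero_double_X ζ (c := ComplexShape.up ℤ) (zero_add 1) (i + 1)
      (by lia) (by lia)).eq_of_tgt

lemma exists_of_homotopy_zero {f : K ⟶ twoTermComplex ζ} (h : Homotopy f 0) :
    ∃ (h₁ : K.X 1 ⟶ Q₀) (h₂ : K.X 2 ⟶ Q₁),
      f.f 0 ≫ (twoTermX₀ ζ).hom = K.d 0 1 ≫ h₁ ∧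
      f.f 1 ≫ (twoTermX₁ ζ).hom = h₁ ≫ ζ + K.d 1 2 ≫ h₂ := by
  refine ⟨h.hom 1 0 ≫ (twoTermX₀ ζ).hom, h.hom 2 1 ≫ (twoTermX₁ ζ).hom, ?_, ?_⟩
  · rw [h.comm 0, dNext_eq h.hom (show (ComplexShape.up ℤ).Rel 0 1 by simp),
      prevD_eq h.hom (show (ComplexShape.up ℤ).Rel (-1) 0 by simp),
      twoTermComplex_d_neg]
    simp
  · rw [h.comm 1, dNext_eq h.hom (show (ComplexShape.up ℤ).Rel 1 2 by simp),
      prevD_eq h.hom (show (ComplexShape.up ℤ).Rel 0 1 by simp), twoTermComplex_d]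
    simp [add_comm]

lemma nonempty_homotopy_zero {f : K ⟶ twoTermComplex ζ} (h₁ : K.X 1 ⟶ Q₀) (h₂ : K.X 2 ⟶ Q₁)
    (hf₀ : f.f 0 ≫ (twoTermX₀ ζ).hom = K.d 0 1 ≫ h₁)
    (hf₁ : f.f 1 ≫ (twoTermX₁ ζ).hom = h₁ ≫ ζ + K.d 1 2 ≫ h₂) :
    Nonempty (Homotopy f 0) := by
  classical
  let H : ∀ i j, K.X i ⟶ (twoTermComplex ζ).X j := fun i j =>
    if h : i = 1 ∧ j = 0 then
      eqToHom (by rw [h.1]) ≫ h₁ ≫ (twoTermX₀ ζ).inv ≫ eqToHom (by rw [h.2])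
    else if h : i = 2 ∧ j = 1 then
      eqToHom (by rw [h.1]) ≫ h₂ ≫ (twoTermX₁ ζ).inv ≫ eqToHom (by rw [h.2])
    else 0
  have hH₁ : H 1 0 = h₁ ≫ (twoTermX₀ ζ).inv := by simp [H]
  have hH₂ : H 2 1 = h₂ ≫ (twoTermX₁ ζ).inv := by simp [H]
  have hf₀' : f.f 0 = K.d 0 1 ≫ h₁ ≫ (twoTermX₀ ζ).inv := by
    rw [← reassoc_of% hf₀]
    simp
  have hf₁' : f.f 1 = h₁ ≫ ζ ≫ (twoTermX₁ ζ).inv + K.d 1 2 ≫ h₂ ≫ (twoTermX₁ ζ).inv := by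
    rw [← cancel_mono (twoTermX₁ ζ).hom, hf₁]
    simp
  refine ⟨{ hom := H, zero := ?_, comm := ?_ }⟩
  · intro i j hij
    have hij' : j + 1 ≠ i := hij
    dsimp only [H]
    rw [dif_neg (by lia), dif_neg (by lia)]
  · intro i
    by_cases hi₀ : i = 0
    · subst hi₀
      rw [dNext_eq H (show (ComplexShape.up ℤ).Rel 0 1 by simp),
        prevD_eq H (show (ComplexShape.up ℤ).Rel (-1) 0 by simp),
        twoTermComplex_d_neg, hH₁, hf₀']
      simp
    by_cases hi₁ : i = 1
    · subst hi₁
      rw [dNext_eq H (show (ComplexShape.up ℤ).Rel 1 2 by simp),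
        prevD_eq H (show (ComplexShape.up ℤ).Rel 0 1 by simp), hH₁, hH₂, hf₁', twoTermComplex_d]
      simp [add_comm]
    apply (isZero_double_X ζ (c := ComplexShape.up ℤ) (zero_add 1) i hi₀ hi₁).eq_of_tgt

/-- Both directions pass between maps on cohomology and maps on terms: extend from cycles by
injectivity, or descend a map on cycles that kills boundaries. -/
lemma forall_homotopy_zero_iff [Injective Q₀] [Injective Q₁] :
    (∀ f : K ⟶ twoTermComplex ζ, Nonempty (Homotopy f 0)) ↔
      (∀ g : K.homology 0 ⟶ Q₀, g ≫ ζ = 0 → g = 0) ∧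
        Function.Surjective (fun h : K.homology 1 ⟶ Q₀ => h ≫ ζ) := by
  refine ⟨fun H => ⟨fun g hg => ?_, fun g => ?_⟩, fun ⟨H₀, H₁⟩ f => ?_⟩
  · obtain ⟨φ₀, hφ₀, hφ₀'⟩ := exists_extend_homology_of_injective K (i := -1) g
    obtain ⟨φ₁, hφ₁⟩ := exists_d_comp_eq_of_injective K (zero_add 1) (φ₀ ≫ ζ)
      (by rw [reassoc_of% hφ₀, hg, comp_zero])
    obtain ⟨f, hf₀, -⟩ := exists_hom_twoTermComplex φ₀ φ₁ hφ₀' hφ₁.symm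
    -- The homotopy makes `φ₀` factor through the differential, hence vanish on cycles.
    obtain ⟨h₁, -, hh, -⟩ := exists_of_homotopy_zero (H f).some
    rw [← cancel_epi (K.homologyπ 0), ← hφ₀, ← hf₀, hh]
    simp
  · obtain ⟨φ₁, hφ₁, hφ₁'⟩ := exists_extend_homology_of_injective K (i := 0) g
    obtain ⟨f, hf₀, hf₁⟩ := exists_hom_twoTermComplex (ζ := ζ) 0 φ₁ (by simp)
      (by rw [hφ₁', zero_comp])
    obtain ⟨h₁, h₂, hh₁, hh₂⟩ := exists_of_homotopy_zero (H f).some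
    -- Since `f` is zero in degree 0, `h₁` kills boundaries and induces the required lift of `g`.
    obtain ⟨k, hk⟩ := exists_homology_desc K (zero_add 1) (K.iCycles 1 ≫ h₁) (by
      rw [toCycles_i_assoc, ← hh₁, hf₀])
    refine ⟨k, ?_⟩
    dsimp only
    rw [← cancel_epi (K.homologyπ 1), ← hφ₁, reassoc_of% hk, ← hf₁, hh₂]
    simp
  · have hcomm : f.f 0 ≫ (twoTermX₀ ζ).hom ≫ ζ = K.d 0 1 ≫ f.f 1 ≫ (twoTermX₁ ζ).hom := by
      have := f.comm 0 1
      rw [twoTermComplex_d] at this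
      rw [← reassoc_of% this]
      simp
    obtain ⟨g, hg⟩ := exists_homology_desc K (neg_add_cancel 1)
      (K.iCycles 0 ≫ f.f 0 ≫ (twoTermX₀ ζ).hom) (by
        rw [toCycles_i_assoc, ← f.comm_assoc, twoTermComplex_d_neg]
        simp)
    have hg₀ : g = 0 := H₀ g (by
      rw [← cancel_epi (K.homologyπ 0), reassoc_of% hg, hcomm]
      simp)
    rw [hg₀, comp_zero] at hg
    obtain ⟨h₁, hh₁⟩ := exists_d_comp_eq_of_injective K (zero_add 1) _ hg.symm
    obtain ⟨l, hl⟩ := exists_homology_desc K (zero_add 1)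
      (K.iCycles 1 ≫ (f.f 1 ≫ (twoTermX₁ ζ).hom - h₁ ≫ ζ)) (by
        rw [toCycles_i_assoc, Preadditive.comp_sub, ← hcomm, reassoc_of% hh₁, sub_self])
    -- `l` measures the failure of `h₁` on cycles in degree 1. The correction `h₁'` extends a lift
    -- of `l` and kills boundaries, so it leaves the degree 0 equation intact.
    obtain ⟨k, rfl⟩ := H₁ l
    obtain ⟨h₁', hh₁', hd⟩ := exists_extend_homology_of_injective K (i := 0) k
    obtain ⟨h₂, hh₂⟩ := exists_d_comp_eq_of_injective K (show (1 : ℤ) + 1 = 2 by norm_num)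
      (f.f 1 ≫ (twoTermX₁ ζ).hom - h₁ ≫ ζ - h₁' ≫ ζ) (by
        rw [Preadditive.comp_sub, ← hl, reassoc_of% hh₁', sub_self])
    refine nonempty_homotopy_zero (h₁ + h₁') h₂ ?_ ?_
    · rw [Preadditive.comp_add, hh₁, hd, add_zero]
    · rw [hh₂, Preadditive.add_comp]
      abel

end HomToTwoTerm

/-! ### The Happel–Reiten–Smalø t-structure -/

section Tilt

open Limits Pretriangulated Triangulated DerivedCategory DerivedCategory.TStructure

variable {A : Type u} [Category.{v} A] [Abelian A]

lemma IsTorsionPair.torsion_of_isZero {𝒯 ℱ : ObjectProperty A} (h : IsTorsionPair 𝒯 ℱ)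
    {X : A} (hX : IsZero X) : 𝒯 X := by
  obtain ⟨S, hS, rfl, hT, -⟩ := h.exists_shortExact X
  have := hS.mono_f
  have := h.torsion_iso
  exact 𝒯.prop_of_iso ((IsZero.of_mono S.f hX).iso hX) hT

lemma IsTorsionPair.torsionFree_of_isZero {𝒯 ℱ : ObjectProperty A} (h : IsTorsionPair 𝒯 ℱ)
    {X : A} (hX : IsZero X) : ℱ X := by
  obtain ⟨S, hS, rfl, -, hF⟩ := h.exists_shortExact X
  have := hS.epi_g
  have := h.torsionFree_iso
  exact ℱ.prop_of_iso ((IsZero.of_epi S.g hX).iso hX) hF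

variable [HasDerivedCategory.{w} A]

/-- Cohomology of a shifted object of the derived category. -/
noncomputable def homologyShiftIso (X : DerivedCategory A) (a n' n : ℤ) (h : a + n' = n) :
    (homologyFunctor A n').obj (X⟦a⟧) ≅ (homologyFunctor A n).obj X :=
  ((homologyFunctor A 0).shiftIso a n' n h).app X

lemma isIso_homology_map_mor₂ {T : Triangle (DerivedCategory A)} (hT : T ∈ distTriang _)
    {n : ℤ} (h : T.obj₁.IsLE (n - 1)) : IsIso ((homologyFunctor A n).map T.mor₂) := by
  have : Mono ((homologyFunctor A n).map T.mor₂) := by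
    rw [HomologySequence.mono_homologyMap_mor₂_iff T hT]
    exact (isZero_of_isLE _ (n - 1) n (by lia)).eq_of_src _ _
  have : Epi ((homologyFunctor A n).map T.mor₂) := by
    rw [HomologySequence.epi_homologyMap_mor₂_iff T hT n (n + 1)]
    exact (isZero_of_isLE _ (n - 1) (n + 1) (by lia)).eq_of_tgt _ _
  exact isIso_of_mono_of_epi _

lemma isIso_homology_map_mor₁ {T : Triangle (DerivedCategory A)} (hT : T ∈ distTriang _)
    {n : ℤ} (h : T.obj₃.IsGE (n + 1)) : IsIso ((homologyFunctor A n).map T.mor₁) := by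
  have : Mono ((homologyFunctor A n).map T.mor₁) := by
    rw [HomologySequence.mono_homologyMap_mor₁_iff T hT (n - 1) n]
    exact (isZero_of_isGE _ (n + 1) (n - 1) (by lia)).eq_of_src _ _
  have : Epi ((homologyFunctor A n).map T.mor₁) := by
    rw [HomologySequence.epi_homologyMap_mor₁_iff T hT]
    exact (isZero_of_isGE _ (n + 1) n (by lia)).eq_of_tgt _ _
  exact isIso_of_mono_of_epi _

/-- The class of all `X` in the derived category with `Hⁱ(X) = 0` for `i > n` and
`Hⁿ(X) ∈ 𝒯`. -/
def tiltLE (𝒯 : ObjectProperty A) (n : ℤ) : ObjectProperty (DerivedCategory A) :=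
  fun X => X.IsLE n ∧ 𝒯 ((homologyFunctor A n).obj X)

/-- The class of all `X` in the derived category with `Hⁱ(X) = 0` for `i < n - 1` and
`Hⁿ⁻¹(X) ∈ ℱ`. -/
def tiltGE (ℱ : ObjectProperty A) (n : ℤ) : ObjectProperty (DerivedCategory A) :=
  fun X => X.IsGE (n - 1) ∧ ℱ ((homologyFunctor A (n - 1)).obj X)

/-- The stalk complexes in degree zero on the objects of a class. -/
def singleImage (P : ObjectProperty A) : ObjectProperty (DerivedCategory A) :=
  fun X => ∃ M, P M ∧ X = (singleFunctor A 0).obj M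

variable {𝒯 ℱ : ObjectProperty A}

lemma hom_eq_zero_of_tilt (h : IsTorsionPair 𝒯 ℱ) {X Y : DerivedCategory A} (f : X ⟶ Y)
    (hX : tiltLE 𝒯 0 X) (hY : tiltGE ℱ 1 Y) : f = 0 := by
  obtain ⟨hX, hX'⟩ := hX
  obtain ⟨hY : Y.IsGE 0, hY'⟩ := hY
  have := h.torsion_iso
  have := h.torsionFree_iso
  obtain ⟨f₁, hf₁⟩ : ∃ f₁, f = (t.truncGEπ 0).app X ≫ f₁ := Triangle.yoneda_exact₂ _
    (t.triangleLEGE_distinguished (-1) 0 (by lia) X) f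
    (t.zero_of_isLE_of_isGE _ (-1) 0 (by lia) (t.isLE_truncLE_obj ..) hY)
  have hX₁ : ((t.truncGE 0).obj X).IsLE 0 := inferInstance
  obtain ⟨f₂, hf₂⟩ : ∃ f₂, f₁ = f₂ ≫ (t.truncLEι 0).app Y := Triangle.coyoneda_exact₂ _
    (t.triangleLEGE_distinguished 0 1 (by lia) Y) f₁
    (t.zero_of_isLE_of_isGE _ 0 1 (by lia) hX₁ (t.isGE_truncGE_obj ..))
  have hY₁ : ((t.truncLE 0).obj Y).IsGE 0 :=
    inferInstanceAs (((t.truncLT 1).obj Y).IsGE 0)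
  have : IsIso ((homologyFunctor A 0).map ((t.truncGEπ 0).app X)) :=
    isIso_homology_map_mor₂ (t.triangleLEGE_distinguished (-1) 0 (by lia) X) (n := 0)
    (t.isLE_truncLE_obj ..)
  have : IsIso ((homologyFunctor A 0).map ((t.truncLEι 0).app Y)) :=
    isIso_homology_map_mor₁ (t.triangleLEGE_distinguished 0 1 (by lia) Y) (n := 0)
    (t.isGE_truncGE_obj ..)
  obtain ⟨M, ⟨eM⟩⟩ := exists_iso_singleFunctor_obj_of_isGE_of_isLE ((t.truncGE 0).obj X) 0
  obtain ⟨N, ⟨eN⟩⟩ := exists_iso_singleFunctor_obj_of_isGE_of_isLE ((t.truncLE 0).obj Y) 0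
  have hM : 𝒯 M := 𝒯.prop_of_iso
    (asIso ((homologyFunctor A 0).map ((t.truncGEπ 0).app X)) ≪≫
      (homologyFunctor A 0).mapIso eM ≪≫ (singleFunctorCompHomologyFunctorIso A 0).app M) hX'
  have hN : ℱ N := ℱ.prop_of_iso
    ((asIso ((homologyFunctor A 0).map ((t.truncLEι 0).app Y))).symm ≪≫
      (homologyFunctor A 0).mapIso eN ≪≫ (singleFunctorCompHomologyFunctorIso A 0).app N) hY'
  -- Up to isomorphism `f₂` joins stalks on `H⁰(X)` and `H⁰(Y)`. Fullness of the stalk functor makes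
  -- it a map from torsion to torsion-free.
  have hf₂' : f₂ = 0 := by
    obtain ⟨g, hg⟩ := (singleFunctor A 0).map_surjective (eM.inv ≫ f₂ ≫ eN.hom)
    rw [h.hom_eq_zero hM hN g, Functor.map_zero] at hg
    rw [← cancel_epi eM.inv, ← cancel_mono eN.hom, Category.assoc, ← hg]
    simp
  rw [hf₁, hf₂, hf₂']
  simp

lemma extensionProduct_le_tiltLE (h : IsTorsionPair 𝒯 ℱ) :
    ObjectProperty.extensionProduct (t.le (-1)) (singleImage 𝒯) ≤ tiltLE 𝒯 0 := by
  rintro X ⟨Y, _, f, g, k, hT, hY, M, hM, rfl⟩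
  have hY' : Y.IsLE (-1) := ⟨hY⟩
  have := h.torsion_iso
  have : IsIso ((homologyFunctor A 0).map g) := isIso_homology_map_mor₂ hT (n := 0) hY'
  exact ⟨t.isLE₂ _ hT 0 (t.isLE_of_le Y (-1) 0)
    (inferInstanceAs (((singleFunctor A 0).obj M).IsLE 0)),
    𝒯.prop_of_iso (asIso ((homologyFunctor A 0).map g) ≪≫
      (singleFunctorCompHomologyFunctorIso A 0).app M).symm hM⟩

lemma extensionProduct_le_tiltGE (h : IsTorsionPair 𝒯 ℱ) :
    ObjectProperty.extensionProduct (singleImage ℱ) (t.ge 1) ≤ tiltGE ℱ 1 := by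
  rintro X ⟨_, Y, f, g, k, hT, ⟨M, hM, rfl⟩, hY⟩
  have hY' : Y.IsGE 1 := ⟨hY⟩
  have := h.torsionFree_iso
  have : IsIso ((homologyFunctor A 0).map f) := isIso_homology_map_mor₁ hT (n := 0) hY'
  exact ⟨t.isGE₂ _ hT 0 (inferInstanceAs (((singleFunctor A 0).obj M).IsGE 0))
    (t.isGE_of_ge Y 0 1),
    ℱ.prop_of_iso ((singleFunctorCompHomologyFunctorIso A 0).symm.app M ≪≫
      asIso ((homologyFunctor A 0).map f)) hM⟩

lemma extensionProduct_tilt (h : IsTorsionPair 𝒯 ℱ) (X : DerivedCategory A) :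
    ObjectProperty.extensionProduct (tiltLE 𝒯 0) (tiltGE ℱ 1) X := by
  apply ObjectProperty.monotone_extensionProduct_left _ (extensionProduct_le_tiltLE h)
  apply ObjectProperty.monotone_extensionProduct_right _ (extensionProduct_le_tiltGE h)
  -- Rebracketing groups the two stalks in the middle, where they assemble `H⁰(X)` by its torsion
  -- sequence.
  rw [ObjectProperty.extensionProduct_assoc, ← ObjectProperty.extensionProduct_assoc _ _ (t.ge 1)]
  have hL : ((t.truncLE 0).obj ((t.truncGE 0).obj X)).IsGE 0 :=
    inferInstanceAs (((t.truncLT 1).obj ((t.truncGE 0).obj X)).IsGE 0)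
  refine ⟨_, _, _, _, _, t.triangleLEGE_distinguished (-1) 0 (by lia) X,
    (t.isLE_truncLE_obj ..).le, _, _, _, _, _,
    t.triangleLEGE_distinguished 0 1 (by lia) ((t.truncGE 0).obj X), ?_,
    (t.isGE_truncGE_obj ..).ge⟩
  obtain ⟨M, ⟨e⟩⟩ := exists_iso_singleFunctor_obj_of_isGE_of_isLE
    ((t.truncLE 0).obj ((t.truncGE 0).obj X)) 0
  obtain ⟨S, hS, rfl, h₁, h₃⟩ := h.exists_shortExact M
  exact ObjectProperty.prop_of_iso _ e.symm
    ⟨_, _, _, _, _, hS.singleTriangle_distinguished, ⟨_, h₁, rfl⟩, ⟨_, h₃, rfl⟩⟩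

/-- The Happel-Reiten-Smalø t-structure of a torsion pair on the unbounded derived category. -/
def tiltTStructure (h : IsTorsionPair 𝒯 ℱ) : TStructure (DerivedCategory A) where
  le := tiltLE 𝒯
  ge := tiltGE ℱ
  le_isClosedUnderIsomorphisms n := ⟨fun e hX => by
    have := h.torsion_iso
    have := hX.1
    exact ⟨t.isLE_of_iso e n, 𝒯.prop_of_iso ((homologyFunctor A n).mapIso e) hX.2⟩⟩
  ge_isClosedUnderIsomorphisms n := ⟨fun e hX => by
    have := h.torsionFree_iso
    have := hX.1
    exact ⟨t.isGE_of_iso e (n - 1), ℱ.prop_of_iso ((homologyFunctor A (n - 1)).mapIso e) hX.2⟩⟩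
  le_shift n a n' hn X hX := by
    have := h.torsion_iso
    have := hX.1
    exact ⟨t.isLE_shift X n a n', 𝒯.prop_of_iso (homologyShiftIso X a n' n hn).symm hX.2⟩
  ge_shift n a n' hn X hX := by
    have := h.torsionFree_iso
    have := hX.1
    exact ⟨t.isGE_shift X (n - 1) a (n' - 1),
      ℱ.prop_of_iso (homologyShiftIso X a (n' - 1) (n - 1) (by lia)).symm hX.2⟩
  zero' _ _ f hX hY := hom_eq_zero_of_tilt h f hX hY
  le_zero_le X hX := by
    have := hX.1
    exact ⟨t.isLE_of_le X 0 1, h.torsion_of_isZero (isZero_of_isLE X 0 1 (by lia))⟩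
  ge_one_le X hX := by
    have := hX.1
    exact ⟨t.isGE_of_ge X (0 - 1) (1 - 1),
      h.torsionFree_of_isZero (isZero_of_isGE X (1 - 1) (0 - 1) (by lia))⟩
  exists_triangle_zero_one X := by
    obtain ⟨Y, Z, f, g, k, hT, hY, hZ⟩ := extensionProduct_tilt h X
    exact ⟨Y, Z, hY, hZ, f, g, k, hT⟩

lemma bounded_hasInducedTStructure (h : IsTorsionPair 𝒯 ℱ) :
    (t (C := A)).bounded.HasInducedTStructure (tiltTStructure h) where
  exists_triangle_zero_one X hX := by
    obtain ⟨Y, Z, f, g, k, hT, hY, hZ⟩ := extensionProduct_tilt h X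
    have hY' : (t (C := A)).minus Y := ⟨0, hY.1⟩
    have hZ' : (t (C := A)).plus Z := ⟨1 - 1, hZ.1⟩
    -- `Y` is bounded above and `Z` below; the triangle with `X` bounded supplies the other two
    -- bounds.
    exact ⟨Y, Z, ⟨hY⟩, ⟨hZ⟩, f, g, k, hT,
      ObjectProperty.le_isoClosure _ _
        ⟨ObjectProperty.ext_of_isTriangulatedClosed₁ _ _ hT hX.1 hZ', hY'⟩,
      ObjectProperty.le_isoClosure _ _
        ⟨hZ', ObjectProperty.ext_of_isTriangulatedClosed₃ _ _ hT hY' hX.2⟩⟩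

lemma exists_tStructure_eq_hrs (h : IsTorsionPair 𝒯 ℱ) :
    ∃ s : TStructure (BoundedDerivedCategory A), s.le 0 = hrsLE 𝒯 ∧ s.ge 0 = hrsGE ℱ := by
  have := bounded_hasInducedTStructure h
  refine ⟨(t (C := A)).bounded.tStructure (tiltTStructure h), ?_, ?_⟩
  · ext X
    exact and_congr_left' (isLE_iff _ _)
  · ext X
    exact and_congr_left' (isGE_iff _ _)

end Tilt

/-! ### Vanishing of morphisms to shifts of the two-term complex -/

section Perp

open Limits DerivedCategory

lemma comp_surjective_iff_of_iso {C : Type u} [Category.{v} C] {Q₀ Q₁ : C} {ζ : Q₀ ⟶ Q₁}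
    {X Y : C} (e : X ≅ Y) :
    Function.Surjective (fun h : X ⟶ Q₀ => h ≫ ζ) ↔
      Function.Surjective (fun h : Y ⟶ Q₀ => h ≫ ζ) := by
  suffices ∀ {X Y : C}, (X ≅ Y) → Function.Surjective (fun h : X ⟶ Q₀ => h ≫ ζ) →
    Function.Surjective (fun h : Y ⟶ Q₀ => h ≫ ζ) from ⟨this e, this e.symm⟩
  intro X Y e H g
  obtain ⟨k, hk⟩ := H (e.hom ≫ g)
  exact ⟨e.inv ≫ k, by simp_all⟩

variable {A : Type u} [Category.{v} A] [Abelian A] [HasDerivedCategory.{w} A]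
  {Q₀ Q₁ : A} {ζ : Q₀ ⟶ Q₁}

/-- For K-injective `L`, localization is bijective on homotopy classes of maps into `L`. -/
lemma forall_hom_Q_eq_zero_iff (K L : CochainComplex A ℤ) [L.IsKInjective] :
    (∀ f : Q.obj K ⟶ Q.obj L, f = 0) ↔ ∀ f : K ⟶ L, Nonempty (Homotopy f 0) := by
  have hbij := CochainComplex.IsKInjective.Qh_map_bijective
    ((HomotopyCategory.quotient A _).obj K) L
  constructor
  · intro H f
    rw [← HomotopyCategory.quotient_map_eq_zero_iff]
    apply hbij.injective
    rw [Functor.map_zero, ← cancel_mono ((quotientCompQhIso A).hom.app L),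
      quotientCompQhIso_hom_naturality, H (Q.map f), comp_zero, zero_comp]
  · intro H f
    obtain ⟨g, hg⟩ := hbij.surjective
      ((quotientCompQhIso A).hom.app K ≫ f ≫ (quotientCompQhIso A).inv.app L)
    obtain ⟨g, rfl⟩ := (HomotopyCategory.quotient A _).map_surjective g
    rw [(HomotopyCategory.quotient_map_eq_zero_iff g).2 (H g), Functor.map_zero] at hg
    rw [← cancel_epi ((quotientCompQhIso A).hom.app K),
      ← cancel_mono ((quotientCompQhIso A).inv.app L), Category.assoc, ← hg]
    simp

lemma forall_hom_twoTerm_eq_zero_iff [Injective Q₀] [Injective Q₁] (X : DerivedCategory A) :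
    (∀ f : X ⟶ twoTerm ζ, f = 0) ↔
      (∀ g : (homologyFunctor A 0).obj X ⟶ Q₀, g ≫ ζ = 0 → g = 0) ∧
        Function.Surjective (fun h : (homologyFunctor A 1).obj X ⟶ Q₀ => h ≫ ζ) := by
  let e := Q.objObjPreimageIso X
  have := twoTermComplex_isKInjective ζ
  have eH (n : ℤ) : (Q.objPreimage X).homology n ≅ (homologyFunctor A n).obj X :=
    (homologyFunctorFactors A n).symm.app _ ≪≫ (homologyFunctor A n).mapIso e
  rw [← comp_surjective_iff_of_iso (eH 1)]
  trans (∀ f : Q.obj (Q.objPreimage X) ⟶ Q.obj (twoTermComplex ζ), f = 0)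
  · constructor
    · intro H f
      exact (cancel_epi e.inv).1 ((H (e.inv ≫ f)).trans comp_zero.symm)
    · intro H f
      exact (cancel_epi e.hom).1 ((H (e.hom ≫ f)).trans comp_zero.symm)
  rw [forall_hom_Q_eq_zero_iff, forall_homotopy_zero_iff]
  refine and_congr_left' ⟨fun H g hg => ?_, fun H g hg => ?_⟩
  · rw [← cancel_epi (eH 0).hom, H ((eH 0).hom ≫ g) (by simp [hg]), comp_zero]
  · rw [← cancel_epi (eH 0).inv, H ((eH 0).inv ≫ g) (by simp [hg]), comp_zero]

lemma forall_hom_twoTerm_shift_eq_zero_iff [Injective Q₀] [Injective Q₁] (X : DerivedCategory A)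
    {i n m : ℤ} (hn : i + n = 0) (hm : n + 1 = m) :
    (∀ f : X ⟶ (twoTerm ζ)⟦i⟧, f = 0) ↔
      (∀ g : (homologyFunctor A n).obj X ⟶ Q₀, g ≫ ζ = 0 → g = 0) ∧
        Function.Surjective (fun h : (homologyFunctor A m).obj X ⟶ Q₀ => h ≫ ζ) := by
  let e₀ := homologyShiftIso X n 0 n (by lia)
  let e₁ := homologyShiftIso X n 1 m (by lia)
  rw [← comp_surjective_iff_of_iso e₁]
  trans (∀ f : X⟦n⟧ ⟶ twoTerm ζ, f = 0)
  · let e : (twoTerm ζ)⟦i⟧⟦n⟧ ≅ twoTerm ζ :=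
      (shiftFunctorCompIsoId _ i n hn).app _
    constructor
    · intro H f
      obtain ⟨g, hg⟩ := (shiftFunctor (DerivedCategory A) n).map_surjective (f ≫ e.inv)
      rw [H g, Functor.map_zero] at hg
      rw [← cancel_mono e.inv, ← hg, zero_comp]
    · intro H f
      apply (shiftFunctor (DerivedCategory A) n).map_injective
      rw [← cancel_mono e.hom, H (_ ≫ e.hom), Functor.map_zero, zero_comp]
  rw [forall_hom_twoTerm_eq_zero_iff]
  refine and_congr_left' ⟨fun H g hg => ?_, fun H g hg => ?_⟩
  · rw [← cancel_epi e₀.hom, H (e₀.hom ≫ g) (by simp [hg]), comp_zero]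
  · rw [← cancel_epi e₀.inv, H (e₀.inv ≫ g) (by simp [hg]), comp_zero]

end Perp

/-! ### The cosilting torsion pair and the perpendicular classes -/

section CosiltingModules

open Limits DerivedCategory

variable {R : Type u} [Ring R] {Q₀ Q₁ T : ModR R} {ζ : Q₀ ⟶ Q₁}

/-- A kernel of `ζ`, with its universal property. -/
lemma IsCosilting.exists_kernel (hT : IsCosilting T ζ) :
    ∃ ι : T ⟶ Q₀, Mono ι ∧ ι ≫ ζ = 0 ∧
      ∀ {X : ModR R} (g : X ⟶ Q₀), g ≫ ζ = 0 → ∃ k : X ⟶ T, k ≫ ι = g := by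
  obtain ⟨ι, hι, hex⟩ := hT.exists_copresentation
  have hmono : Mono ι := (ModuleCat.mono_iff_injective ι).2 hι
  have hzero : ι ≫ ζ = 0 := by
    ext x
    exact hex.apply_apply_eq_zero x
  let S := ShortComplex.mk ι ζ hzero
  have hS : S.Exact := (ShortComplex.ShortExact.moduleCat_exact_iff_function_exact S).2 hex
  have : Mono S.f := hmono
  exact ⟨ι, hmono, hzero, fun g hg => ⟨hS.lift g hg, hS.lift_f g hg⟩⟩

lemma IsCosilting.leftHomOrthogonal_iff (hT : IsCosilting T ζ) (X : ModR R) :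
    leftHomOrthogonal T X ↔ ∀ g : X ⟶ Q₀, g ≫ ζ = 0 → g = 0 := by
  obtain ⟨ι, _, hι, hlift⟩ := hT.exists_kernel
  constructor
  · intro H g hg
    obtain ⟨k, rfl⟩ := hlift g hg
    rw [H k, zero_comp]
  · intro H f
    rw [← cancel_mono ι, H (f ≫ ι) (by simp [hι]), zero_comp]

lemma hom_eq_zero_of_cogen {X Y : ModR R} (hX : leftHomOrthogonal T X) (hY : Cogen T Y)
    (f : X ⟶ Y) : f = 0 := by
  obtain ⟨I, j, hj⟩ := hY
  ext x
  apply hj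
  rw [ModuleCat.hom_zero, LinearMap.zero_apply, map_zero]
  funext i
  have := hX (f ≫ j ≫ ModuleCat.ofHom (LinearMap.proj i))
  exact congr($this x)

lemma classB_isClosedUnderIsomorphisms : (classB ζ).IsClosedUnderIsomorphisms :=
  ⟨fun e => (comp_surjective_iff_of_iso e).1⟩

lemma leftHomOrthogonal_isClosedUnderIsomorphisms :
    (leftHomOrthogonal T).IsClosedUnderIsomorphisms :=
  ⟨fun e H f => by rw [← cancel_epi e.hom, H (e.hom ≫ f), comp_zero]⟩

lemma leftHomOrthogonal_of_isZero {X : ModR R} (hX : IsZero X) : leftHomOrthogonal T X :=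
  fun _ => hX.eq_of_src _ _

lemma classB_of_isZero {X : ModR R} (hX : IsZero X) : classB ζ X :=
  fun _ => ⟨0, hX.eq_of_src _ _⟩

lemma IsCosilting.isZero (hT : IsCosilting T ζ) {X : ModR R} (h₁ : leftHomOrthogonal T X)
    (h₂ : classB ζ X) : IsZero X := by
  rw [IsZero.iff_id_eq_zero]
  rw [← hT.cogen_eq] at h₂
  exact hom_eq_zero_of_cogen h₁ h₂ _

/-- The map from a module to the product of copies of `T` indexed by all its morphisms
to `T`. -/
def toProduct (X T : ModR R) : X →ₗ[Rᵐᵒᵖ] ((X ⟶ T) → T) :=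
  LinearMap.pi fun f => f.hom

/-- The short complex given by the reject of `T` in `X` and the corresponding quotient. -/
def rejectShortComplex (X T : ModR R) : ShortComplex (ModR R) :=
  ShortComplex.mk (ModuleCat.ofHom (LinearMap.ker (toProduct X T)).subtype)
    (ModuleCat.ofHom (LinearMap.ker (toProduct X T)).mkQ) (by
      ext x
      exact (Submodule.Quotient.mk_eq_zero _).2 x.2)

lemma rejectShortComplex_shortExact (X T : ModR R) : (rejectShortComplex X T).ShortExact where
  exact := (ShortComplex.ShortExact.moduleCat_exact_iff_function_exact _).2
    (LinearMap.exact_subtype_mkQ _)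
  mono_f := (ModuleCat.mono_iff_injective _).2 Subtype.val_injective
  epi_g := (ModuleCat.epi_iff_surjective _).2 (Submodule.mkQ_surjective _)

lemma rejectShortComplex_f_comp {X T : ModR R} (f : X ⟶ T) :
    (rejectShortComplex X T).f ≫ f = 0 := by
  ext x
  exact congrFun (LinearMap.mem_ker.1 x.2) f

lemma cogen_rejectShortComplex (X T : ModR R) : Cogen T (rejectShortComplex X T).X₃ :=
  ⟨X ⟶ T, ModuleCat.ofHom ((LinearMap.ker (toProduct X T)).liftQ (toProduct X T) le_rfl),
    LinearMap.ker_eq_bot.1 (Submodule.ker_liftQ_eq_bot _ _ _ le_rfl)⟩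

/-- Any map from the reject to `T` extends to `X`, but every map from `X` to `T` kills the reject.
To extend, go first to `Q₀` by injectivity, then correct by a map from the quotient, available since
the quotient lies in `Cogen(T) = B_ζ`, so as to land in the kernel of `ζ`. -/
lemma IsCosilting.leftHomOrthogonal_reject (hT : IsCosilting T ζ) (X : ModR R) :
    leftHomOrthogonal T (rejectShortComplex X T).X₁ := by
  have := hT.injective₀
  obtain ⟨ι, _, hι, hlift⟩ := hT.exists_kernel
  have hS := rejectShortComplex_shortExact X T
  have : Mono (rejectShortComplex X T).f := hS.mono_f
  have : Epi (rejectShortComplex X T).g := hS.epi_g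
  have hB : classB ζ (rejectShortComplex X T).X₃ := by
    rw [← hT.cogen_eq]
    exact cogen_rejectShortComplex X T
  intro (f : (rejectShortComplex X T).X₁ ⟶ T)
  let g : (rejectShortComplex X T).X₂ ⟶ Q₀ := Injective.factorThru (f ≫ ι) (rejectShortComplex X T).f
  have hg : (rejectShortComplex X T).f ≫ g = f ≫ ι := Injective.comp_factorThru _ _
  obtain ⟨h, hh⟩ := hB (hS.exact.desc (g ≫ ζ) (by rw [reassoc_of% hg, hι, comp_zero]))
  obtain ⟨k, hk⟩ := hlift (g - (rejectShortComplex X T).g ≫ h) (by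
    dsimp only at hh
    rw [Preadditive.sub_comp, Category.assoc, hh, hS.exact.g_desc, sub_self])
  have hk₀ : (rejectShortComplex X T).f ≫ k ≫ ι = 0 := by
    rw [← Category.assoc, rejectShortComplex_f_comp (X := X) k, zero_comp]
  rw [hk, Preadditive.comp_sub, ShortComplex.zero_assoc, zero_comp, sub_zero, hg] at hk₀
  rw [← cancel_mono ι, hk₀, zero_comp]

lemma IsCosilting.isTorsionPair (hT : IsCosilting T ζ) :
    IsTorsionPair (leftHomOrthogonal T) (classB ζ) where
  torsion_iso := leftHomOrthogonal_isClosedUnderIsomorphisms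
  torsionFree_iso := classB_isClosedUnderIsomorphisms
  hom_eq_zero X Y hX hY f := by
    rw [← hT.cogen_eq] at hY
    exact hom_eq_zero_of_cogen hX hY f
  exists_shortExact X := ⟨rejectShortComplex X T, rejectShortComplex_shortExact X T, rfl,
    hT.leftHomOrthogonal_reject X, by
      rw [← hT.cogen_eq]
      exact cogen_rejectShortComplex X T⟩

variable [HasDerivedCategory.{w} (ModR R)]

lemma IsCosilting.forall_hom_twoTerm_shift_eq_zero_iff (hT : IsCosilting T ζ)
    (X : DerivedCategory (ModR R)) {i n m : ℤ} (hn : i + n = 0) (hm : n + 1 = m) :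
    (∀ f : X ⟶ (twoTerm ζ)⟦i⟧, f = 0) ↔
      leftHomOrthogonal T ((homologyFunctor (ModR R) n).obj X) ∧
        classB ζ ((homologyFunctor (ModR R) m).obj X) := by
  have := hT.injective₀
  have := hT.injective₁
  rw [Cosilting.forall_hom_twoTerm_shift_eq_zero_iff X hn hm, hT.leftHomOrthogonal_iff]
  rfl

lemma IsCosilting.perpLE_eq_hrsLE (hT : IsCosilting T ζ) :
    restrictBounded (perpLE 0 (twoTerm ζ)) = hrsLE (leftHomOrthogonal T) := by
  ext ⟨X, hX⟩
  constructor
  · intro H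
    have H' (n : ℤ) (hn : 0 ≤ n) :=
      (hT.forall_hom_twoTerm_shift_eq_zero_iff X (neg_add_cancel n) rfl).1 (H (-n) (by lia))
    -- For `n > 0`, shifts `-n` and `1 - n` are both allowed and put `Hⁿ` in both classes; for `n =
    -- 0` only the first is.
    refine ⟨fun n hn => hT.isZero (H' n hn.le).1 ?_, (H' 0 le_rfl).1⟩
    have := (H' (n - 1) (by lia)).2
    rwa [sub_add_cancel] at this
  · rintro ⟨H, H₀⟩ i hi
    refine (hT.forall_hom_twoTerm_shift_eq_zero_iff X (add_neg_cancel i) rfl).2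
      ⟨?_, classB_of_isZero (H _ (by lia))⟩
    obtain hi | rfl := hi.lt_or_eq
    · exact leftHomOrthogonal_of_isZero (H _ (by lia))
    · exact H₀

lemma IsCosilting.perpGT_eq_hrsGE (hT : IsCosilting T ζ) :
    restrictBounded (perpGT 1 (twoTerm ζ)) = hrsGE (classB ζ) := by
  ext ⟨X, hX⟩
  constructor
  · intro H
    have H' (n : ℤ) (hn : n < -1) :=
      (hT.forall_hom_twoTerm_shift_eq_zero_iff X (neg_add_cancel n) rfl).1 (H (-n) (by lia))
    -- Membership in `B_ζ` uses shift `1 - n > 1`, so it reaches `n = -1`, one degree beyond the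
    -- torsion condition.
    have H₂ (n : ℤ) (hn : n < 0) : classB ζ ((homologyFunctor (ModR R) n).obj X) := by
      have := (H' (n - 1) (by lia)).2
      rwa [sub_add_cancel] at this
    exact ⟨fun n hn => hT.isZero (H' n hn).1 (H₂ n (by lia)), H₂ (-1) (by lia)⟩
  · rintro ⟨H, H₁⟩ i hi
    refine (hT.forall_hom_twoTerm_shift_eq_zero_iff X (add_neg_cancel i) rfl).2
      ⟨leftHomOrthogonal_of_isZero (H _ (by lia)), ?_⟩
    obtain hm | hm : -i + 1 < -1 ∨ -i + 1 = -1 := by lia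
    · exact classB_of_isZero (H _ hm)
    · rw [hm]
      exact H₁

end CosiltingModules

end Cosilting

theorem mainTheorem4 {R : Type u} [Ring R] [HasDerivedCategory.{w} (Cosilting.ModR R)]
    (Q₀ Q₁ : Cosilting.ModR R) (ζ : Q₀ ⟶ Q₁) (T : Cosilting.ModR R)
    (hT : Cosilting.IsCosilting T ζ) :
    Cosilting.IsTorsionPair (Cosilting.leftHomOrthogonal T) (Cosilting.classB ζ) ∧
    ∃ t : Triangulated.TStructure (Cosilting.BoundedDerivedCategory (Cosilting.ModR R)),
      t.le 0 = Cosilting.restrictBounded (Cosilting.perpLE 0 (Cosilting.twoTerm ζ)) ∧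
      t.ge 0 = Cosilting.restrictBounded (Cosilting.perpGT 1 (Cosilting.twoTerm ζ)) ∧
      t.le 0 = Cosilting.hrsLE (Cosilting.leftHomOrthogonal T) ∧
      t.ge 0 = Cosilting.hrsGE (Cosilting.classB ζ) := by
  obtain ⟨t, hle, hge⟩ := Cosilting.exists_tStructure_eq_hrs hT.isTorsionPair
  exact ⟨hT.isTorsionPair, t, hle.trans hT.perpLE_eq_hrsLE.symm,
    hge.trans hT.perpGT_eq_hrsGE.symm, hle, hge⟩
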